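/- Let $W\ge 1$ be the number of supernets and $T$ the number of iterations. At iteration $t$ a subnet $a^{(t)}$ is sampled and assigned to one supernet $I^{(t)}\in[W]$; write $c_t(w)=\mathcal L(\theta^{(t,w)},a^{(t)})\in[0,1]$ for its objective value on supernet $w$, where $\theta^{(t,w)}$ are the parameters of supernet $w$ at iteration $t$. The regret of the assignment is $$R_T=\sum_{t=1}^T c_t(I^{(t)})-\min_{(w_1,\dots,w_T)\in[W]^T}\ \sum_{t=1}^T c_t(w_t).$$ (i) If QAS chooses $I^{(t)}\in\arg\min_{w\in[W]}c_t(w)$ at every iteration $t$ (with any tie-breaking), then $R_T\le 0$, whatever the parameters and the sampled subnets are. For (ii) and (iii), a (randomized) $W$-armed adversarial bandit algorithm with horizon $T$ chooses $I^{(t)}$ as a function of its internal random seed (independent of the costs, which are fixed in advance) and of the arms $I^{(s)}$ chosen before and their costs $c_s(I^{(s)})$, $s<t$; the costs of the other arms are not revealed to it. Expectation and probability are over the seed. (ii) There is an absolute constant $\kappa>0$ such that for all $W\ge2$, all $T$ and every bandit algorithm there are costs $c_1,\dots,c_T:[W]\to[0,1]$ for which the regret of the algorithm satisfies $\mathbb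 E[R_T]\ge\kappa T$; that is, the worst-case regret of the best bandit algorithm is $\Omega(T)$. (iii) For all $W\ge2$, $\delta\in(0,1/4)$, $T\ge 32(W-1)\log(2/\delta)$ and every bandit algorithm there are costs $c_1,\dots,c_T:[W]\to[0,1]$ for which $$\mathbb P\left(R_T\ge\frac1{27}\sqrt{(W-1)\,T\log\frac1{4\delta}}\right)\ge\frac\delta2 .$$ -/

import Mathlib

open MeasureTheory

/-- The regret of the assignment `I` of the `T` rounds to the `W` supernets (arms), where
`c t w` is the cost of supernet `w` in round `t`; the comparator is the best *sequence* of
supernets in hindsight. (The infimum runs over a finite set, which is non-empty as soon as an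
assignment `I` exists, so it is a minimum.) -/
noncomputable def regret {T W : ℕ} (c : Fin T → Fin W → ℝ) (I : Fin T → Fin W) : ℝ :=
  ∑ t, c t (I t) - ⨅ w : Fin T → Fin W, ∑ t, c t (w t)

/-- The objective values `L (θ⁽ᵗ'ʷ⁾, a⁽ᵗ⁾)` of the subnet sampled in round `t` on each supernet. -/
def objectiveCosts {Θ S : Type*} {T W : ℕ} (L : Θ → S → ℝ) (θ : Fin T → Fin W → Θ)
    (a : Fin T → S) : Fin T → Fin W → ℝ :=
  fun t w => L (θ t w) (a t)

/-- The QAS rule: in every round the selected supernet attains the minimal cost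
(ties broken arbitrarily). -/
def IsArgminAssignment {T W : ℕ} (c : Fin T → Fin W → ℝ) (I : Fin T → Fin W) : Prop :=
  ∀ t w, c t (I t) ≤ c t w

/-- A (randomized) `W`-armed adversarial bandit algorithm with horizon `T`, whose internal
randomness is a seed in `Ω`. In round `t` it chooses an arm from the seed and from what it has
observed before: for every round `s < t` the arm chosen and the cost of that arm. -/
structure BanditAlgorithm (Ω : Type*) [MeasurableSpace Ω] (T W : ℕ) where
  /-- The arm chosen in round `t`, given the observations so far and the seed. -/
  choose : (t : Fin T) → (Fin t → Fin W × ℝ) → Ω → Fin W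
  measurable_choose : ∀ t h, Measurable (choose t h)

/-- The arms that a bandit algorithm plays against the cost sequence `c`, with seed `ω`. -/
def BanditAlgorithm.play {Ω : Type*} [MeasurableSpace Ω] {T W : ℕ} (A : BanditAlgorithm Ω T W)
    (c : Fin T → Fin W → ℝ) (ω : Ω) (t : Fin T) : Fin W :=
  A.choose t
    (fun s : Fin t =>
      (A.play c ω ⟨s, s.isLt.trans t.isLt⟩,
        c ⟨s, s.isLt.trans t.isLt⟩ (A.play c ω ⟨s, s.isLt.trans t.isLt⟩))) ω
termination_by t.val
decreasing_by all_goals exact s.isLt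

/-! The comparator may change arms every round, so it pays the sum of the roundwise minima; the
argmin rule pays no more. For the lower bounds, let a fair bit per round decide whether arm `a` or
all the other arms cost 1. The comparator pays 0, while the past says nothing about the next bit:
for each seed, the map from bits to the player's losses is a bijection (`flipLosses_bijective`), so
at least half of the bit sequences cost at least `T / 2`. Averaging over the seed yields one fixed
sequence with regret at least `T / 2` with probability at least 1/2. Markov's inequality then gives
the expectation bound, and the bound in probability asks for less than this. -/

lemma regret_nonneg {T W : ℕ} (c : Fin T → Fin W → ℝ) (I : Fin T → Fin W) : 0 ≤ regret c I :=
  sub_nonneg.2 (ciInf_le (Set.finite_range _).bddBelow I)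

lemma regret_nonpos_of_isArgminAssignment {T W : ℕ} {c : Fin T → Fin W → ℝ} {I : Fin T → Fin W}
    (h : IsArgminAssignment c I) : regret c I ≤ 0 := by
  have : Nonempty (Fin T → Fin W) := ⟨I⟩
  exact sub_nonpos.2 (le_ciInf fun w => Finset.sum_le_sum fun t _ => h t (w t))

namespace BanditAlgorithm

variable {Ω : Type*} [MeasurableSpace Ω] {T W : ℕ} (A : BanditAlgorithm Ω T W)

lemma measurable_play_apply (c : Fin T → Fin W → ℝ) (t : Fin T) :
    Measurable fun ω => A.play c ω t := by
  induction t using WellFoundedLT.induction with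
  | ind t ih =>
    let arms : Ω → Fin t → Fin W := fun ω s => A.play c ω ⟨s, s.isLt.trans t.isLt⟩
    have arms_meas : Measurable arms := measurable_pi_lambda _ fun s => ih _ s.isLt
    -- As `c` is fixed, past arms determine the observed costs. The history thus ranges over a
    -- finite set, and joint measurability reduces to measurability for each fixed history.
    let next : (Fin t → Fin W) → Ω → Fin W := fun p ω =>
      A.choose t (fun s => (p s, c ⟨s, s.isLt.trans t.isLt⟩ (p s))) ω
    have next_meas : Measurable fun q : Ω × (Fin t → Fin W) => next q.2 q.1 :=
      measurable_from_prod_countable_left fun p =>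
        A.measurable_choose t fun s => (p s, c ⟨s, s.isLt.trans t.isLt⟩ (p s))
    have key : (fun ω => A.play c ω t) = fun ω => next (arms ω) ω := by
      funext ω
      rw [play]
    rw [key]
    exact next_meas.comp (measurable_id.prodMk arms_meas)

lemma measurable_play (c : Fin T → Fin W → ℝ) : Measurable (A.play c) :=
  measurable_pi_lambda _ fun t => A.measurable_play_apply c t

lemma measurable_regret (c : Fin T → Fin W → ℝ) : Measurable fun ω => regret c (A.play c ω) :=
  (Measurable.of_discrete (f := regret c)).comp (A.measurable_play c)

lemma integrable_regret (μ : Measure Ω) [IsFiniteMeasure μ] (c : Fin T → Fin W → ℝ) :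
    Integrable (fun ω => regret c (A.play c ω)) μ := by
  obtain ⟨C, hC⟩ := (Set.finite_range (regret c)).bddAbove
  refine Integrable.of_bound (A.measurable_regret c).aestronglyMeasurable C (.of_forall fun ω => ?_)
  rw [Real.norm_of_nonneg (regret_nonneg _ _)]
  exact hC ⟨_, rfl⟩

/-- The arm of a round depends only on the costs of the earlier rounds. -/
lemma play_congr {c c' : Fin T → Fin W → ℝ} (ω : Ω) (t : Fin T) (h : ∀ s < t, c s = c' s) :
    A.play c ω t = A.play c' ω t := by
  induction t using WellFoundedLT.induction with
  | ind t ih =>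
    rw [play, play]
    congr 1
    funext s
    have hs : (⟨s, s.isLt.trans t.isLt⟩ : Fin T) < t := s.isLt
    rw [ih _ hs fun r hr => h r (hr.trans hs), h _ hs]

end BanditAlgorithm

/-- Costs in `{0, 1}` for which, in round `t`, the arm `a` is bad if `x t`, and the other arms
are bad otherwise. -/
def flipCosts {T W : ℕ} (a : Fin W) (x : Fin T → Bool) (t : Fin T) (w : Fin W) : ℝ :=
  if decide (w = a) = x t then 1 else 0

lemma flipCosts_mem_Icc {T W : ℕ} (a : Fin W) (x : Fin T → Bool) (t : Fin T) (w : Fin W) :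
    flipCosts a x t w ∈ Set.Icc (0 : ℝ) 1 := by
  unfold flipCosts
  split_ifs <;> simp

/-- The comparator pays nothing against flip costs. -/
lemma sum_flipCosts_le_regret {T W : ℕ} {a b : Fin W} (hab : b ≠ a) (x : Fin T → Bool)
    (I : Fin T → Fin W) : ∑ t, flipCosts a x t (I t) ≤ regret (flipCosts a x) I := by
  -- One of `a` and `b` is free in every round; the witness always picks that one.
  have h := ciInf_le (f := fun w : Fin T → Fin W => ∑ t, flipCosts a x t (w t))
    (Set.finite_range _).bddBelow fun t => if x t then b else a
  have h0 : ∑ t, flipCosts a x t (if x t then b else a) = 0 :=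
    Finset.sum_eq_zero fun t _ => by cases hx : x t <;> simp [flipCosts, hx, hab]
  simp only [h0] at h
  unfold regret
  linarith

/-- The rounds in which an algorithm pays against flip costs. -/
def flipLosses {Ω : Type*} [MeasurableSpace Ω] {T W : ℕ} (A : BanditAlgorithm Ω T W) (a : Fin W)
    (ω : Ω) (x : Fin T → Bool) (t : Fin T) : Bool :=
  decide (decide (A.play (flipCosts a x) ω t = a) = x t)

/-- The arm in round `t` depends only on the earlier bits; once these are recovered, the loss in
round `t` determines `x t`. -/
lemma flipLosses_bijective {Ω : Type*} [MeasurableSpace Ω] {T W : ℕ} (A : BanditAlgorithm Ω T W)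
    (a : Fin W) (ω : Ω) : Function.Bijective (flipLosses A a ω) := by
  refine Finite.injective_iff_bijective.1 fun x x' hxx => funext fun t => ?_
  induction t using WellFoundedLT.induction with
  | ind t ih =>
    have hplay := A.play_congr (c := flipCosts a x) (c' := flipCosts a x') ω t fun s hs => by
      funext w
      simp only [flipCosts, ih s hs]
    have h := congrFun hxx t
    simp only [flipLosses, hplay] at h
    generalize decide (A.play (flipCosts a x') ω t = a) = d at h
    revert h
    cases d <;> cases x t <;> cases x' t <;> simp

lemma sum_flipCosts_play {Ω : Type*} [MeasurableSpace Ω] {T W : ℕ} (A : BanditAlgorithm Ω T W)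
    (a : Fin W) (ω : Ω) (x : Fin T → Bool) :
    ∑ t, flipCosts a x t (A.play (flipCosts a x) ω t) =
      (Finset.univ.filter fun t => flipLosses A a ω x t = true).card := by
  simp [flipCosts, flipLosses, Finset.sum_boole]

/-- At least half of the Boolean sequences have at least as many `true` as `false` entries. -/
lemma two_pow_le_two_mul_card_majority (T : ℕ) :
    2 ^ T ≤ 2 * (Finset.univ.filter fun y : Fin T → Bool =>
      T ≤ 2 * (Finset.univ.filter fun t => y t = true).card).card := by
  set M : Finset (Fin T → Bool) := Finset.univ.filter fun y =>
    T ≤ 2 * (Finset.univ.filter fun t => y t = true).card with hM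
  have hneg : Function.Injective fun (y : Fin T → Bool) t => !y t := fun y z h => by
    funext t
    simpa using congrFun h t
  -- If `true` is in the minority, negating every entry puts it in the majority.
  have hcover : Finset.univ ⊆ M ∪ M.image fun y t => !y t := by
    intro y _
    by_cases hy : y ∈ M
    · exact Finset.mem_union_left _ hy
    refine Finset.mem_union_right _ (Finset.mem_image.2 ⟨fun t => !y t, ?_, by simp⟩)
    have hsum := Finset.card_filter_add_card_filter_not (s := Finset.univ) fun t => y t = true
    simp only [hM, Finset.mem_filter, Finset.mem_univ, true_and, Finset.card_univ,
      Fintype.card_fin, Bool.not_eq_true, Bool.not_eq_true'] at hy hsum ⊢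
    omega
  have h := (Finset.card_le_card hcover).trans (Finset.card_union_le _ _)
  rw [Finset.card_image_of_injective _ hneg] at h
  simp only [Finset.card_univ, Fintype.card_fun, Fintype.card_bool, Fintype.card_fin] at h
  omega

/-- For every seed, at least half of the flip costs cause a regret of at least `T / 2`. -/
lemma two_pow_le_two_mul_card_regret {Ω : Type*} [MeasurableSpace Ω] {T W : ℕ}
    (A : BanditAlgorithm Ω T W) {a b : Fin W} (hab : b ≠ a) (ω : Ω) :
    (2 : ℝ) ^ T ≤ 2 * ∑ x : Fin T → Bool,
      {ω | (T : ℝ) / 2 ≤ regret (flipCosts a x) (A.play (flipCosts a x) ω)}.indicator 1 ω := by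
  have hmaj : (2 : ℝ) ^ T ≤ 2 * ∑ y : Fin T → Bool,
      if T ≤ 2 * (Finset.univ.filter fun t => y t = true).card then (1 : ℝ) else 0 := by
    rw [Finset.sum_boole]
    exact_mod_cast two_pow_le_two_mul_card_majority T
  -- Reindexing turns a count of loss patterns into a count of bit sequences.
  rw [← (flipLosses_bijective A a ω).sum_comp] at hmaj
  refine hmaj.trans (mul_le_mul_of_nonneg_left (Finset.sum_le_sum fun x _ => ?_) zero_le_two)
  split_ifs with hx
  · rw [Set.indicator_of_mem]
    · rfl
    have h := sum_flipCosts_le_regret hab x (A.play (flipCosts a x) ω)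
    rw [sum_flipCosts_play] at h
    have hx' : (T : ℝ) ≤ 2 * (Finset.univ.filter fun t => flipLosses A a ω x t = true).card := by
      exact_mod_cast hx
    simp only [Set.mem_ofPred_eq]
    linarith
  · exact Set.indicator_nonneg (fun _ _ => zero_le_one) _

/-- Every bandit algorithm has, on some costs, regret at least `T / 2` with probability at least
one half. -/
theorem exists_costs_half_le_measureReal_regret {Ω : Type*} [MeasurableSpace Ω] (μ : Measure Ω)
    [IsProbabilityMeasure μ] {T W : ℕ} (hW : 2 ≤ W) (A : BanditAlgorithm Ω T W) :
    ∃ c : Fin T → Fin W → ℝ, (∀ t w, c t w ∈ Set.Icc (0 : ℝ) 1) ∧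
      1 / 2 ≤ μ.real {ω | (T : ℝ) / 2 ≤ regret c (A.play c ω)} := by
  let a : Fin W := ⟨0, by omega⟩
  let b : Fin W := ⟨1, by omega⟩
  have hab : b ≠ a := by simp [a, b]
  by_contra! hcon
  let S : (Fin T → Bool) → Set Ω := fun x =>
    {ω | (T : ℝ) / 2 ≤ regret (flipCosts a x) (A.play (flipCosts a x) ω)}
  have hS : ∀ x, MeasurableSet (S x) := fun x =>
    measurableSet_le measurable_const (A.measurable_regret _)
  have hint : ∀ x, Integrable ((S x).indicator (1 : Ω → ℝ)) μ := fun x =>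
    (integrable_const 1).indicator (hS x)
  -- Integrating the seedwise count bounds the average of `μ.real (S x)` over `x` below by 1/2, so
  -- not all of them can be smaller.
  have hle : (2 : ℝ) ^ T ≤ 2 * ∑ x, μ.real (S x) := calc
    (2 : ℝ) ^ T = ∫ _, (2 : ℝ) ^ T ∂μ := by simp
    _ ≤ ∫ ω, 2 * ∑ x, (S x).indicator 1 ω ∂μ :=
      integral_mono (integrable_const _)
        ((integrable_finsetSum _ fun x _ => hint x).const_mul 2)
        fun ω => two_pow_le_two_mul_card_regret A hab ω
    _ = 2 * ∑ x, μ.real (S x) := by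
      rw [integral_const_mul, integral_finsetSum _ fun x _ => hint x]
      simp only [integral_indicator_one (hS _)]
  have hlt : ∑ x, μ.real (S x) < ∑ _x : Fin T → Bool, (1 / 2 : ℝ) :=
    Finset.sum_lt_sum_of_nonempty Finset.univ_nonempty fun x _ =>
      hcon (flipCosts a x) (flipCosts_mem_Icc a x)
  simp at hlt
  linarith

/-- The condition on `T` gives `(W - 1) * log (1 / (4 * δ)) ≤ T`, so the root is at most `T`. The
constants 32 and 1/27 leave ample slack. -/
lemma sqrt_mul_log_le_half {T W : ℕ} {δ : ℝ} (hW : 2 ≤ W) (hδ : δ ∈ Set.Ioo (0 : ℝ) (1 / 4))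
    (hT : 32 * ((W : ℝ) - 1) * Real.log (2 / δ) ≤ T) :
    1 / 27 * Real.sqrt (((W : ℝ) - 1) * T * Real.log (1 / (4 * δ))) ≤ T / 2 := by
  obtain ⟨hδ0, hδ1⟩ := hδ
  have hW1 : (0 : ℝ) ≤ (W : ℝ) - 1 := by
    have : (2 : ℝ) ≤ W := by exact_mod_cast hW
    linarith
  have hlog : Real.log (1 / (4 * δ)) ≤ Real.log (2 / δ) := by
    refine Real.log_le_log (by positivity) ?_
    rw [div_le_div_iff₀ (by positivity) hδ0]
    linarith
  have hlog0 : 0 ≤ Real.log (2 / δ) := Real.log_nonneg (by rw [le_div_iff₀ hδ0]; linarith)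
  have hT0 : (0 : ℝ) ≤ T := T.cast_nonneg
  have hmul : ((W : ℝ) - 1) * Real.log (1 / (4 * δ)) ≤ T := by
    have h1 := mul_le_mul_of_nonneg_left hlog hW1
    have h2 := mul_nonneg hW1 hlog0
    linarith
  have hsqrt : Real.sqrt (((W : ℝ) - 1) * T * Real.log (1 / (4 * δ))) ≤ T := by
    refine Real.sqrt_le_iff.2 ⟨hT0, ?_⟩
    have := mul_le_mul_of_nonneg_left hmul hT0
    linarith
  linarith

theorem theorem1 :
    -- the QAS rule has non-positive regret
    (∀ (Θ : Type*) (S : Type*) (L : Θ → S → ℝ) (T W : ℕ) (θ : Fin T → Fin W → Θ)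
        (a : Fin T → S) (I : Fin T → Fin W),
        (∀ t w, L (θ t w) (a t) ∈ Set.Icc (0 : ℝ) 1) →
        IsArgminAssignment (objectiveCosts L θ a) I →
        regret (objectiveCosts L θ a) I ≤ 0) ∧
    -- every bandit algorithm has expected regret of order at least `T` on some costs
    (∃ κ : ℝ, 0 < κ ∧
      ∀ (Ω : Type*) [MeasurableSpace Ω] (μ : Measure Ω) [IsProbabilityMeasure μ]
        (T W : ℕ), 2 ≤ W → ∀ A : BanditAlgorithm Ω T W,
        ∃ c : Fin T → Fin W → ℝ, (∀ t w, c t w ∈ Set.Icc (0 : ℝ) 1) ∧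
          κ * (T : ℝ) ≤ ∫ ω, regret c (A.play c ω) ∂μ) ∧
    -- the explicit lower bound in probability
    (∀ (Ω : Type*) [MeasurableSpace Ω] (μ : Measure Ω) [IsProbabilityMeasure μ]
        (T W : ℕ) (δ : ℝ), 2 ≤ W → δ ∈ Set.Ioo (0 : ℝ) (1 / 4) →
        32 * ((W : ℝ) - 1) * Real.log (2 / δ) ≤ (T : ℝ) →
        ∀ A : BanditAlgorithm Ω T W,
        ∃ c : Fin T → Fin W → ℝ, (∀ t w, c t w ∈ Set.Icc (0 : ℝ) 1) ∧
          δ / 2 ≤ μ.real {ω | 1 / 27 * Real.sqrt (((W : ℝ) - 1) * T * Real.log (1 / (4 * δ)))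
            ≤ regret c (A.play c ω)}) := by
  refine ⟨fun Θ S L T W θ a I _ hI => regret_nonpos_of_isArgminAssignment hI,
    ⟨1 / 4, by norm_num, fun Ω _ μ _ T W hW A => ?_⟩, fun Ω _ μ _ T W δ hW hδ hT A => ?_⟩
  · obtain ⟨c, hc, hhalf⟩ := exists_costs_half_le_measureReal_regret μ hW A
    refine ⟨c, hc, ?_⟩
    -- Markov at level `T / 2` with probability 1/2 gives the constant 1/4.
    have hmarkov := mul_meas_ge_le_integral_of_nonneg
      (.of_forall fun ω => regret_nonneg c (A.play c ω)) (A.integrable_regret μ c) ((T : ℝ) / 2)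
    have hT0 : (0 : ℝ) ≤ (T : ℝ) / 2 := by positivity
    have := mul_le_mul_of_nonneg_left hhalf hT0
    linarith
  · obtain ⟨c, hc, hhalf⟩ := exists_costs_half_le_measureReal_regret μ hW A
    refine ⟨c, hc, ?_⟩
    calc δ / 2 ≤ 1 / 2 := by linarith [hδ.2]
      _ ≤ _ := hhalf
      _ ≤ _ := measureReal_mono fun ω hω => (sqrt_mul_log_le_half hW hδ hT).trans hω
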